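/- For a positive integer $n$ write $[n]=\{1,\dots,n\}$ and let $\binom{[n]}{k}$ be the family of all $k$-element subsets of $[n]$. A family $\mathcal F\subset\binom{[n]}{k}$ is said to have property $U(s,q)$ if $|F_1\cup\dots\cup F_s|\le q$ for all choices of (not necessarily distinct) $F_1,\dots,F_s\in\mathcal F$. For integers $p,r$ put $$\mathcal A(p,r,n,k)=\Big\{A\in\binom{[n]}{k}: |A\cap[p]|\ge r\Big\}.$$ **Theorem.** Let $n,s,t$ be integers with $s>t\ge 1$ and $5(s+t)\le n\le \frac{(s+t)^2}{3t}$. If $\mathcal F\subset\binom{[n]}{3}$ has property $U(s,2s+t)$, then $$|\mathcal F|\le|\mathcal A(s+t,2,n,3)|.$$ Moreover, $\mathcal A(s+t,2,n,3)$ itself has property $U(s,2s+t)$, so it is a family of maximum size with this property. -/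

import Mathlib

/-- The complete `k`-uniform family `binom([n], k)` of all `k`-element subsets of
`[n] = {1, ..., n}`. -/
def kSubsets (n k : ℕ) : Finset (Finset ℕ) :=
  (Finset.Icc 1 n).powersetCard k

/-- The property `U(s, q)`: the union of any `s` members of `F`, not necessarily distinct,
has at most `q` elements. -/
def HasPropU (s q : ℕ) (F : Finset (Finset ℕ)) : Prop :=
  ∀ f : Fin s → Finset ℕ, (∀ i, f i ∈ F) → (Finset.univ.biUnion f).card ≤ q

/-- The family `A(p, r, n, k)` of all `k`-element subsets `A` of `[n]` with
`|A ∩ [p]| ≥ r`. -/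
def familyA (p r n k : ℕ) : Finset (Finset ℕ) :=
  (kSubsets n k).filter fun A => r ≤ (A ∩ Finset.Icc 1 p).card

/-! Write p = s + t. Shifting preserves the size and the union property, so the family may be taken
shifted. Its triples are counted by largest element c, through the pairs below c. Everything turns
on the t triples {i, 2t+3-i, 2s+t+1}, 2 ≤ i ≤ t+1, whose lower pairs partition [2, 2t+1].

If one of them is missing, then for c > 2s+t every pair below c meets [t] or lies in (t, 2t], so
there are at most t(c-1) of them. The bound n ≤ p²/(3t) makes the total small enough
(`card_le_of_not_mem`).

If all are present, let u be least with {1, p+1, p+2+u} missing. For u ≥ 1, these triples together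
with {1, p+1, p+1+u} and {2, p+1-u, 2s+t+1} would yield s members covering [2s+t+1]
(`HasPropU.not_covering`), so the last one is missing; for u = 0 it is missing by shiftedness. Hence
the pairs below c lie in [p] once c ≥ p+2+u, and once c > 2s+t those avoiding 1 lie in [2, p-u].
What may be gained over the extremal family at small c is outweighed by the loss at large c, because
n ≥ 5p (`card_le_of_mem`). -/

/-! ### Shifting and the union property -/

/-- Replace `j` by `i` in `A`, when `j ∈ A`, `i ∉ A` and the result is not yet in `F`. -/
def shiftSet (i j : ℕ) (F : Finset (Finset ℕ)) (A : Finset ℕ) : Finset ℕ :=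
  if j ∈ A ∧ i ∉ A ∧ insert i (A.erase j) ∉ F then insert i (A.erase j) else A

/-- The `(i, j)`-shift of a family of sets. -/
def shiftFamily (i j : ℕ) (F : Finset (Finset ℕ)) : Finset (Finset ℕ) :=
  F.image (shiftSet i j F)

lemma erase_insert_erase {i j : ℕ} {A : Finset ℕ} (hj : j ∈ A) (hi : i ∉ A) :
    insert j ((insert i (A.erase j)).erase i) = A := by
  ext x; grind

lemma shiftSet_injOn (i j : ℕ) (F : Finset (Finset ℕ)) :
    Set.InjOn (shiftSet i j F) F := by
  intro A hA B hB h
  have hA' : A ∈ F := hA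
  have hB' : B ∈ F := hB
  unfold shiftSet at h
  split_ifs at h with h1 h2 h2
  · rw [← erase_insert_erase h1.1 h1.2.1, ← erase_insert_erase h2.1 h2.2.1, h]
  · exact absurd (h ▸ hB') h1.2.2
  · exact absurd (h ▸ hA') h2.2.2
  · exact h

lemma card_shiftFamily (i j : ℕ) (F : Finset (Finset ℕ)) :
    (shiftFamily i j F).card = F.card :=
  Finset.card_image_of_injOn (shiftSet_injOn i j F)

lemma shiftFamily_subset_kSubsets {i j n k : ℕ} {F : Finset (Finset ℕ)} (hi : 1 ≤ i)
    (hij : i < j) (hF : F ⊆ kSubsets n k) : shiftFamily i j F ⊆ kSubsets n k := by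
  intro B hB
  obtain ⟨A, hA, rfl⟩ := Finset.mem_image.1 hB
  have hA' := hF hA
  unfold shiftSet
  split_ifs with h
  · simp only [kSubsets, Finset.mem_powersetCard] at hA' ⊢
    have hjn := Finset.mem_Icc.1 (hA'.1 h.1)
    refine ⟨?_, ?_⟩
    · intro x hx
      rcases Finset.mem_insert.1 hx with rfl | hx
      · exact Finset.mem_Icc.2 ⟨hi, by omega⟩
      · exact hA'.1 (Finset.mem_of_mem_erase hx)
    · rw [Finset.card_insert_of_notMem (by simp [h.2.1]), Finset.card_erase_of_mem h.1, hA'.2]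
      have := Finset.card_pos.2 ⟨j, h.1⟩
      omega
  · exact hA'

lemma card_le_of_agree_off_pair {i j : ℕ} {X Y : Finset ℕ}
    (hXY : ∀ x, x ≠ i → x ≠ j → x ∈ X → x ∈ Y)
    (h : (j ∉ X ∧ (i ∈ X → j ∈ Y)) ∨ (i ∈ Y ∧ j ∈ Y)) : X.card ≤ Y.card := by
  rcases h with ⟨hj, hi⟩ | ⟨hi, hj⟩
  · by_cases hiX : i ∈ X
    · have hsub : insert j (X.erase i) ⊆ Y := by
        intro x hx
        have := hi hiX
        grind
      have := Finset.card_le_card hsub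
      rw [Finset.card_insert_of_notMem (by simp [hj]), Finset.card_erase_of_mem hiX] at this
      have := Finset.card_pos.2 ⟨i, hiX⟩
      omega
    · exact Finset.card_le_card fun x hx => hXY x (by grind) (by grind) hx
  · refine Finset.card_le_card fun x hx => ?_
    by_cases h1 : x = i
    · exact h1 ▸ hi
    · by_cases h2 : x = j
      · exact h2 ▸ hj
      · exact hXY x h1 h2 hx

/-- The union of shifted sets is compared with a union of members of `F` agreeing with it off {i,
j}. The preimages serve unless j survives in some `f m` while another set was shifted; then `f m` is
traded for a member containing i. -/
lemma HasPropU.shiftFamily {i j s q : ℕ} {F : Finset (Finset ℕ)} (hij : i ≠ j)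
    (hF : HasPropU s q F) : HasPropU s q (shiftFamily i j F) := by
  intro f hf
  choose g hgF hg using fun l => Finset.mem_image.1 (hf l)
  have key : ∀ l, (g l = f l) ∨
      (j ∈ g l ∧ i ∉ g l ∧ f l = insert i ((g l).erase j)) := by
    intro l
    have := hg l
    unfold shiftSet at this
    split_ifs at this with h
    · exact Or.inr ⟨h.1, h.2.1, this.symm⟩
    · exact Or.inl this
  have hoff : ∀ l x, x ≠ i → x ≠ j → (x ∈ f l ↔ x ∈ g l) := by
    intro l x hxi hxj
    rcases key l with h | ⟨_, _, h⟩
    · rw [h]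
    · rw [h]; simp [hxi, hxj]
  by_cases hall : ∀ l, g l = f l
  · rw [show f = g from funext fun l => (hall l).symm]
    exact hF g hgF
  push Not at hall
  obtain ⟨l₀, hl₀⟩ := hall
  have hl₀' := (key l₀).resolve_left hl₀
  by_cases hj : ∃ m, j ∈ f m
  · obtain ⟨m, hm⟩ := hj
    have hgm : g m = f m := by
      rcases key m with h | ⟨_, _, h⟩
      · exact h
      · rw [h] at hm; simp [hij.symm] at hm
    have hml : l₀ ≠ m := fun h => hl₀ (h ▸ hgm)
    obtain ⟨B, hBF, hiB, hBoff⟩ : ∃ B ∈ F, i ∈ B ∧ ∀ x, x ≠ i → x ≠ j → (x ∈ f m ↔ x ∈ B) := by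
      by_cases him : i ∈ f m
      · exact ⟨f m, hgm ▸ hgF m, him, fun _ _ _ => Iff.rfl⟩
      -- `f m` kept j although i is absent, so the shift was blocked: its target was already in `F`.
      · refine ⟨insert i ((f m).erase j), ?_, by simp, ?_⟩
        · by_contra hcon
          have h1 := hg m
          rw [hgm] at h1
          unfold shiftSet at h1
          rw [if_pos ⟨hm, him, hcon⟩] at h1
          exact him (h1 ▸ Finset.mem_insert_self _ _)
        · intro x hxi hxj
          simp [hxi, hxj]
    have hmem : ∀ l, Function.update g m B l ∈ F := by
      intro l
      by_cases h : l = m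
      · subst h; simpa using hBF
      · simpa [h] using hgF l
    refine le_trans (card_le_of_agree_off_pair (i := i) (j := j) ?_ (Or.inr ⟨?_, ?_⟩))
      (hF (Function.update g m B) hmem)
    · intro x hxi hxj hx
      simp only [Finset.mem_biUnion, Finset.mem_univ, true_and] at hx ⊢
      obtain ⟨l, hl⟩ := hx
      refine ⟨l, ?_⟩
      by_cases h : l = m
      · subst h; simpa using (hBoff x hxi hxj).1 hl
      · simpa [h] using (hoff l x hxi hxj).1 hl
    · simp only [Finset.mem_biUnion, Finset.mem_univ, true_and]
      exact ⟨m, by simpa using hiB⟩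
    · simp only [Finset.mem_biUnion, Finset.mem_univ, true_and]
      exact ⟨l₀, by simpa [hml] using hl₀'.1⟩
  · refine le_trans (card_le_of_agree_off_pair (i := i) (j := j) ?_ (Or.inl ⟨?_, ?_⟩)) (hF g hgF)
    · intro x hxi hxj hx
      simp only [Finset.mem_biUnion, Finset.mem_univ, true_and] at hx ⊢
      obtain ⟨l, hl⟩ := hx
      exact ⟨l, (hoff l x hxi hxj).1 hl⟩
    · simpa using hj
    · intro _
      simp only [Finset.mem_biUnion, Finset.mem_univ, true_and]
      exact ⟨l₀, hl₀'.1⟩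

/-! ### Reduction to shifted families -/

/-- A family is shifted when it is closed under replacing an element by a smaller positive one. -/
def IsShifted (F : Finset (Finset ℕ)) : Prop :=
  ∀ A ∈ F, ∀ i j, 1 ≤ i → i < j → j ∈ A → i ∉ A → insert i (A.erase j) ∈ F

lemma sum_shiftFamily_lt {i j : ℕ} {F : Finset (Finset ℕ)} (hij : i < j) {A : Finset ℕ}
    (hA : A ∈ F) (hj : j ∈ A) (hi : i ∉ A) (hns : insert i (A.erase j) ∉ F) :
    ∑ B ∈ shiftFamily i j F, ∑ x ∈ B, x < ∑ B ∈ F, ∑ x ∈ B, x := by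
  have hlt : ∀ B : Finset ℕ, j ∈ B → i ∉ B → ∑ x ∈ insert i (B.erase j), x < ∑ x ∈ B, x := by
    intro B hjB hiB
    rw [Finset.sum_insert (by simp [hiB]), ← Finset.add_sum_erase B (fun x => x) hjB]
    omega
  unfold shiftFamily
  rw [Finset.sum_image (shiftSet_injOn i j F)]
  refine Finset.sum_lt_sum (fun B _ => ?_) ⟨A, hA, ?_⟩
  · unfold shiftSet
    split_ifs with h
    · exact (hlt B h.1 h.2.1).le
    · exact le_rfl
  · unfold shiftSet
    rw [if_pos ⟨hj, hi, hns⟩]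
    exact hlt A hj hi

/-- Each effective shift lowers the total of all elements of all members, so the process terminates.
-/
lemma exists_isShifted {n k s q : ℕ} (F : Finset (Finset ℕ)) (hF : F ⊆ kSubsets n k)
    (hU : HasPropU s q F) :
    ∃ G : Finset (Finset ℕ), G ⊆ kSubsets n k ∧ HasPropU s q G ∧ G.card = F.card ∧
      IsShifted G := by
  induction hw : ∑ B ∈ F, ∑ x ∈ B, x using Nat.strong_induction_on generalizing F with
  | _ w ih =>
    by_cases hs : IsShifted F
    · exact ⟨F, hF, hU, rfl, hs⟩
    · unfold IsShifted at hs
      push Not at hs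
      obtain ⟨A, hA, i, j, hi, hij, hjA, hiA, hns⟩ := hs
      obtain ⟨G, h1, h2, h3, h4⟩ := ih _ (hw ▸ sum_shiftFamily_lt hij hA hjA hiA hns) _
        (shiftFamily_subset_kSubsets hi hij hF) (hU.shiftFamily hij.ne) rfl
      exact ⟨G, h1, h2, h3.trans (card_shiftFamily i j F), h4⟩

/-- Lowering the smallest entry first, then the middle one, keeps the entries distinct at every
stage. -/
lemma IsShifted.triple {F : Finset (Finset ℕ)} (hF : IsShifted F) {a b c a' b' c' : ℕ}
    (h : {a, b, c} ∈ F) (hab : a < b) (hbc : b < c) (ha' : 1 ≤ a') (hab' : a' < b')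
    (hbc' : b' < c') (haa : a' ≤ a) (hbb : b' ≤ b) (hcc : c' ≤ c) : {a', b', c'} ∈ F := by
  have h1 : {a', b, c} ∈ F := by
    rcases haa.eq_or_lt with rfl | hlt
    · exact h
    · convert hF _ h a' a ha' hlt (by simp) (by grind) using 1
      ext x; grind
  have h2 : {a', b', c} ∈ F := by
    rcases hbb.eq_or_lt with rfl | hlt
    · exact h1
    · convert hF _ h1 b' b (by omega) hlt (by simp) (by grind) using 1
      ext x; grind
  rcases hcc.eq_or_lt with rfl | hlt
  · exact h2
  · convert hF _ h2 c' c (by omega) hlt (by simp) (by grind) using 1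
    ext x; grind

/-! ### The extremal family -/

/-- Each member has at most one element outside [s+t], so s of them cover at most (s+t) + s
elements. -/
lemma hasPropU_familyA_two (n s t : ℕ) : HasPropU s (2 * s + t) (familyA (s + t) 2 n 3) := by
  intro f hf
  have hsub : Finset.univ.biUnion f ⊆
      Finset.Icc 1 (s + t) ∪ Finset.univ.biUnion fun i => f i \ Finset.Icc 1 (s + t) := by
    intro x hx
    simp only [Finset.mem_biUnion, Finset.mem_univ, true_and, Finset.mem_union,
      Finset.mem_sdiff] at hx ⊢
    obtain ⟨i, hi⟩ := hx
    by_cases h : x ∈ Finset.Icc 1 (s + t)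
    · exact Or.inl h
    · exact Or.inr ⟨i, hi, h⟩
  have hone : ∀ i ∈ (Finset.univ : Finset (Fin s)), (f i \ Finset.Icc 1 (s + t)).card ≤ 1 := by
    intro i _
    have h := hf i
    simp only [familyA, kSubsets, Finset.mem_filter, Finset.mem_powersetCard] at h
    have := Finset.card_sdiff_add_card_inter (f i) (Finset.Icc 1 (s + t))
    omega
  have h1 := Finset.card_biUnion_le_card_mul _ _ 1 hone
  have h2 := (Finset.card_le_card hsub).trans (Finset.card_union_le _ _)
  simp only [Finset.card_univ, Fintype.card_fin, Nat.card_Icc] at h1 h2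
  omega

lemma le_card_familyA_two {n p : ℕ} (hpn : p ≤ n) :
    p.choose 3 + (n - p) * p.choose 2 ≤ (familyA p 2 n 3).card := by
  have hinj : Set.InjOn (fun x : ℕ × Finset ℕ => insert x.1 x.2)
      (Finset.Icc (p + 1) n ×ˢ (Finset.Icc 1 p).powersetCard 2 : Finset (ℕ × Finset ℕ)) := by
    rintro ⟨c, A⟩ hA ⟨d, B⟩ hB h
    simp only [Finset.coe_product, Set.mem_prod, Finset.mem_coe, Finset.mem_Icc,
      Finset.mem_powersetCard] at hA hB h
    have hcA : ∀ x ∈ A, x ≤ p := fun x hx => (Finset.mem_Icc.1 (hA.2.1 hx)).2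
    have hcB : ∀ x ∈ B, x ≤ p := fun x hx => (Finset.mem_Icc.1 (hB.2.1 hx)).2
    have hcd : c = d := by
      have : c ∈ insert d B := h ▸ Finset.mem_insert_self c A
      grind
    subst hcd
    have : A = B := by
      ext x
      have := Finset.ext_iff.1 h x
      grind
    rw [this]
  have hdisj : Disjoint ((Finset.Icc 1 p).powersetCard 3)
      ((Finset.Icc (p + 1) n ×ˢ (Finset.Icc 1 p).powersetCard 2).image
        fun x : ℕ × Finset ℕ => insert x.1 x.2) := by
    rw [Finset.disjoint_left]
    rintro A hA hA'
    obtain ⟨⟨c, B⟩, hB, rfl⟩ := Finset.mem_image.1 hA'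
    simp only [Finset.mem_product, Finset.mem_Icc, Finset.mem_powersetCard] at hA hB
    have := Finset.mem_Icc.1 (hA.1 (Finset.mem_insert_self c B))
    omega
  have hcard := Finset.card_union_of_disjoint hdisj
  rw [Finset.card_image_of_injOn hinj] at hcard
  simp only [Finset.card_product, Finset.card_powersetCard, Nat.card_Icc,
    Nat.add_sub_cancel, Nat.add_sub_add_right] at hcard
  rw [← hcard]
  refine Finset.card_le_card fun A hA => ?_
  simp only [familyA, kSubsets, Finset.mem_filter, Finset.mem_powersetCard]
  rcases Finset.mem_union.1 hA with hA | hA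
  · rw [Finset.mem_powersetCard] at hA
    refine ⟨⟨hA.1.trans (Finset.Icc_subset_Icc_right hpn), hA.2⟩, ?_⟩
    rw [Finset.inter_eq_left.2 hA.1, hA.2]
    norm_num
  · obtain ⟨⟨c, B⟩, hB, rfl⟩ := Finset.mem_image.1 hA
    simp only [Finset.mem_product, Finset.mem_Icc, Finset.mem_powersetCard] at hB
    have hc : c ∉ B := fun h => by
      have := Finset.mem_Icc.1 (hB.2.1 h)
      omega
    refine ⟨⟨?_, ?_⟩, ?_⟩
    · refine Finset.insert_subset (Finset.mem_Icc.2 ⟨by omega, hB.1.2⟩)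
        (hB.2.1.trans (Finset.Icc_subset_Icc_right hpn))
    · rw [Finset.card_insert_of_notMem hc, hB.2.2]
    · rw [← hB.2.2]
      exact Finset.card_le_card fun x hx =>
        Finset.mem_inter.2 ⟨Finset.mem_insert_of_mem hx, hB.2.1 hx⟩

/-! ### Counting triples by their largest element -/

/-- The pairs `(a, b)` with `1 ≤ a < b < c` such that `{a, b, c}` is a member of `F`. -/
def lowerLink (F : Finset (Finset ℕ)) (c : ℕ) : Finset (ℕ × ℕ) :=
  (Finset.Icc 1 (c - 1) ×ˢ Finset.Icc 1 (c - 1)).filter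
    fun x => x.1 < x.2 ∧ {x.1, x.2, c} ∈ F

lemma mem_lowerLink {F : Finset (Finset ℕ)} {c a b : ℕ} :
    (a, b) ∈ lowerLink F c ↔ 1 ≤ a ∧ a < b ∧ b < c ∧ {a, b, c} ∈ F := by
  simp only [lowerLink, Finset.mem_filter, Finset.mem_product, Finset.mem_Icc]
  constructor
  · rintro ⟨⟨⟨h1, h2⟩, h3, h4⟩, h5, h6⟩
    exact ⟨h1, h5, by omega, h6⟩
  · rintro ⟨h1, h5, h4, h6⟩
    exact ⟨⟨⟨h1, by omega⟩, by omega, by omega⟩, h5, h6⟩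

lemma exists_sorted_triple {A : Finset ℕ} (hA : A.card = 3) :
    ∃ a b c, a < b ∧ b < c ∧ A = {a, b, c} := by
  obtain ⟨x, y, z, hxy, hxz, hyz, rfl⟩ := Finset.card_eq_three.1 hA
  rcases lt_or_gt_of_ne hxy with h1 | h1 <;> rcases lt_or_gt_of_ne hxz with h2 | h2 <;>
    rcases lt_or_gt_of_ne hyz with h3 | h3
  · exact ⟨x, y, z, h1, h3, rfl⟩
  · exact ⟨x, z, y, h2, h3, by ext; grind⟩
  · omega
  · exact ⟨z, x, y, h2, h1, by ext; grind⟩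
  · exact ⟨y, x, z, h1, h2, by ext; grind⟩
  · omega
  · exact ⟨y, z, x, h3, h2, by ext; grind⟩
  · exact ⟨z, y, x, h3, h1, by ext; grind⟩

lemma card_le_sum_lowerLink {n : ℕ} {F : Finset (Finset ℕ)} (hF : F ⊆ kSubsets n 3) :
    F.card ≤ ∑ k ∈ Finset.range n, (lowerLink F (k + 1)).card := by
  have hsub : F ⊆ (Finset.range n).biUnion fun k =>
      (lowerLink F (k + 1)).image fun x => {x.1, x.2, k + 1} := by
    intro A hA
    have hA' := Finset.mem_powersetCard.1 (hF hA)
    obtain ⟨a, b, c, hab, hbc, rfl⟩ := exists_sorted_triple hA'.2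
    have ha := Finset.mem_Icc.1 (hA'.1 (show a ∈ ({a, b, c} : Finset ℕ) by simp))
    have hc := Finset.mem_Icc.1 (hA'.1 (show c ∈ ({a, b, c} : Finset ℕ) by simp))
    obtain ⟨k, rfl⟩ : ∃ k, c = k + 1 := ⟨c - 1, by omega⟩
    refine Finset.mem_biUnion.2 ⟨k, Finset.mem_range.2 (by omega), Finset.mem_image.2
      ⟨(a, b), mem_lowerLink.2 ⟨ha.1, hab, hbc, hA⟩, rfl⟩⟩
  exact (Finset.card_le_card hsub).trans (Finset.card_biUnion_le.trans
    (Finset.sum_le_sum fun k _ => Finset.card_image_le))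

lemma card_le_choose_two {l m : ℕ} {D : Finset (ℕ × ℕ)}
    (hD : ∀ a b, (a, b) ∈ D → l < a ∧ a < b ∧ b ≤ m) : D.card ≤ (m - l).choose 2 := by
  have h : D.card ≤ ((Finset.Ioc l m).powersetCard 2).card := by
    refine Finset.card_le_card_of_injOn (fun x => {x.1, x.2}) ?_ ?_
    · rintro ⟨a, b⟩ hx
      have := hD a b hx
      rw [Finset.mem_coe, Finset.mem_powersetCard]
      refine ⟨?_, Finset.card_pair (by omega)⟩
      intro x hx
      simp only [Finset.mem_insert, Finset.mem_singleton] at hx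
      rw [Finset.mem_Ioc]
      omega
    · rintro ⟨a, b⟩ hx ⟨a', b'⟩ hx' h
      have h1 := hD a b hx
      have h2 := hD a' b' hx'
      have e := Finset.ext_iff.1 h
      have e1 := e a
      have e2 := e b
      simp only [Finset.mem_insert, Finset.mem_singleton] at e1 e2
      ext <;> simp only <;> grind
  simpa using h

lemma sum_sub_add_choose_two_le (t N : ℕ) (h : t ≤ N) :
    ∑ a ∈ Finset.range t, (N - (a + 1)) + t.choose 2 ≤ t * N := by
  induction t with
  | zero => simp
  | succ t ih =>
    have h1 := ih (by omega)
    have h2 : (t + 1).choose 2 = t + t.choose 2 := by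
      rw [Nat.choose_succ_succ' t 1, Nat.choose_one_right]
    rw [Finset.sum_range_succ, h2]
    have : (t + 1) * N = t * N + N := by ring
    omega

/-- Pairs with a ≤ t number t(c-1) - C(t+1, 2); the deficit absorbs the at most C(t, 2) pairs inside
(t, 2t]. -/
lemma card_le_mul_of_cover {t c : ℕ} (htc : t < c) {D : Finset (ℕ × ℕ)}
    (hD : ∀ a b, (a, b) ∈ D → 1 ≤ a ∧ a < b ∧ b < c ∧ (t < a → b ≤ 2 * t)) :
    D.card ≤ t * (c - 1) := by
  have h1 : (D.filter fun x => t < x.1).card ≤ (2 * t - t).choose 2 := by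
    refine card_le_choose_two fun a b hab => ?_
    rw [Finset.mem_filter] at hab
    have := hD a b hab.1
    exact ⟨hab.2, this.2.1, this.2.2.2 hab.2⟩
  have h2 : (D.filter fun x => ¬ t < x.1).card ≤ ∑ a ∈ Finset.range t, (c - 1 - (a + 1)) := by
    have hsub : (D.filter fun x => ¬ t < x.1) ⊆ (Finset.range t).biUnion fun a =>
        (Finset.Ioc (a + 1) (c - 1)).image fun b => (a + 1, b) := by
      rintro ⟨a, b⟩ hab
      rw [Finset.mem_filter] at hab
      have := hD a b hab.1
      simp only at hab
      refine Finset.mem_biUnion.2 ⟨a - 1, Finset.mem_range.2 (by omega), Finset.mem_image.2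
        ⟨b, Finset.mem_Ioc.2 ⟨by omega, by omega⟩, ?_⟩⟩
      rw [Nat.sub_add_cancel this.1]
    refine (Finset.card_le_card hsub).trans (Finset.card_biUnion_le.trans
      (Finset.sum_le_sum fun a _ => Finset.card_image_le.trans ?_))
    simp
  have h3 := Finset.card_filter_add_card_filter_not (s := D) (fun x => t < x.1)
  have h4 := sum_sub_add_choose_two_le t (c - 1) (by omega)
  have h5 : 2 * t - t = t := by omega
  rw [h5] at h1
  omega

lemma card_le_star_add_choose_two {p l : ℕ} {D : Finset (ℕ × ℕ)}
    (hD : ∀ a b, (a, b) ∈ D → 1 ≤ a ∧ a < b ∧ b ≤ p ∧ (1 < a → b ≤ l)) :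
    D.card ≤ (p - 1) + (l - 1).choose 2 := by
  have h1 : (D.filter fun x => 1 < x.1).card ≤ (l - 1).choose 2 := by
    refine card_le_choose_two fun a b hab => ?_
    rw [Finset.mem_filter] at hab
    have := hD a b hab.1
    exact ⟨hab.2, this.2.1, this.2.2.2 hab.2⟩
  have h2 : (D.filter fun x => ¬ 1 < x.1).card ≤ p - 1 := by
    have hsub : (D.filter fun x => ¬ 1 < x.1) ⊆ (Finset.Ioc 1 p).image fun b => (1, b) := by
      rintro ⟨a, b⟩ hab
      rw [Finset.mem_filter] at hab
      have := hD a b hab.1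
      simp only at hab
      obtain rfl : a = 1 := by omega
      exact Finset.mem_image.2 ⟨b, Finset.mem_Ioc.2 ⟨by omega, by omega⟩, rfl⟩
    refine (Finset.card_le_card hsub).trans (Finset.card_image_le.trans ?_)
    simp
  have h3 := Finset.card_filter_add_card_filter_not (s := D) (fun x => 1 < x.1)
  omega

/-! ### The covering obstruction -/

lemma HasPropU.not_covering {s t u : ℕ} {F : Finset (Finset ℕ)} (hF : IsShifted F)
    (hU : HasPropU s (2 * s + t) F) (hu : 1 ≤ u) (hus : u ≤ s - t) (ht : 1 ≤ t) (hst : t < s)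
    (h1 : {1, s + t + 1, s + t + 1 + u} ∈ F)
    (h2 : ∀ i, 2 ≤ i → i ≤ t + 1 → {i, 2 * t + 3 - i, 2 * s + t + 1} ∈ F) :
    {2, s + t + 1 - u, 2 * s + t + 1} ∉ F := by
  intro h3
  -- The first u sets cover 1 and [s+t+2-u, s+t+1+u]. The lower pairs of the next t cover [2, 2t+1],
  -- and the middle entries of the last s-u-t cover [2t+2, s+t+1-u]. The largest entries of the last
  -- two groups cover [s+t+2+u, 2s+t+1].
  let f : ℕ → Finset ℕ := fun k =>
    if k < u then {1, s + t + 2 - u + k, s + t + 1 + u - k}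
    else if k < u + t then {k - u + 2, 2 * t + 1 - (k - u), s + t + 2 + k}
    else {2, 2 * t + 2 + (k - u - t), s + t + 2 + k}
  have hfF : ∀ k, k < s → f k ∈ F := by
    intro k hk
    simp only [f]
    split_ifs with hku hkt
    · exact hF.triple h1 (by omega) (by omega) (by omega) (by omega) (by omega) (by omega)
        (by omega) (by omega)
    · exact hF.triple (h2 (k - u + 2) (by omega) (by omega)) (by omega) (by omega) (by omega)
        (by omega) (by omega) (by omega) (by omega) (by omega)
    · exact hF.triple h3 (by omega) (by omega) (by omega)
        (by omega) (by omega) (by omega) (by omega) (by omega)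
  have hcov : ∀ x, 1 ≤ x → x ≤ 2 * s + t + 1 → ∃ k, k < s ∧ x ∈ f k := by
    have hA : ∀ k x, k < u → (x = 1 ∨ x = s + t + 2 - u + k ∨ x = s + t + 1 + u - k) →
        x ∈ f k := by
      intro k x hk hx
      simp only [f, if_pos hk, Finset.mem_insert, Finset.mem_singleton]
      exact hx
    have hB : ∀ k x, u ≤ k → k < u + t →
        (x = k - u + 2 ∨ x = 2 * t + 1 - (k - u) ∨ x = s + t + 2 + k) → x ∈ f k := by
      intro k x hk hk' hx
      simp only [f, if_neg hk.not_gt, if_pos hk', Finset.mem_insert, Finset.mem_singleton]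
      exact hx
    have hC : ∀ k x, u + t ≤ k →
        (x = 2 ∨ x = 2 * t + 2 + (k - u - t) ∨ x = s + t + 2 + k) → x ∈ f k := by
      intro k x hk hx
      have hk' : ¬ k < u := by omega
      simp only [f, if_neg hk', if_neg hk.not_gt, Finset.mem_insert, Finset.mem_singleton]
      exact hx
    intro x hx1 hx2
    rcases Nat.lt_or_ge x 2 with h | h
    · exact ⟨0, by omega, hA _ _ (by omega) (by omega)⟩
    rcases Nat.lt_or_ge x (t + 2) with h | h
    · exact ⟨u + x - 2, by omega, hB _ _ (by omega) (by omega) (by omega)⟩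
    rcases Nat.lt_or_ge x (2 * t + 2) with h | h
    · exact ⟨u + 2 * t + 1 - x, by omega, hB _ _ (by omega) (by omega) (by omega)⟩
    rcases Nat.lt_or_ge x (s + t + 2 - u) with h | h
    · exact ⟨u + x - t - 2, by omega, hC _ _ (by omega) (by omega)⟩
    rcases Nat.lt_or_ge x (s + t + 2) with h | h
    · exact ⟨x - (s + t + 2 - u), by omega, hA _ _ (by omega) (by omega)⟩
    rcases Nat.lt_or_ge x (s + t + 2 + u) with h | h
    · exact ⟨s + t + 1 + u - x, by omega, hA _ _ (by omega) (by omega)⟩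
    refine ⟨x - (s + t + 2), by omega, ?_⟩
    rcases Nat.lt_or_ge (x - (s + t + 2)) (u + t) with h' | h'
    · exact hB _ _ (by omega) (by omega) (by omega)
    · exact hC _ _ (by omega) (by omega)
  have hle := hU (fun i => f i) (fun i => hfF i i.2)
  have hsub : Finset.Icc 1 (2 * s + t + 1) ⊆ Finset.univ.biUnion fun i : Fin s => f i := by
    intro x hx
    rw [Finset.mem_Icc] at hx
    obtain ⟨k, hk, hxk⟩ := hcov x hx.1 hx.2
    exact Finset.mem_biUnion.2 ⟨⟨k, hk⟩, Finset.mem_univ _, hxk⟩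
  have := Finset.card_le_card hsub
  rw [Nat.card_Icc] at this
  omega

/-! ### Numerical inequalities -/

lemma cast_choose_three (n : ℕ) : (n.choose 3 : ℝ) = n * (n - 1) * (n - 2) / 6 := by
  induction n with
  | zero => simp
  | succ n ih =>
    rw [Nat.choose_succ_succ' n 2]
    push_cast
    rw [ih, Nat.cast_choose_two]
    ring

lemma sum_range_choose_two (n : ℕ) : ∑ k ∈ Finset.range n, k.choose 2 = n.choose 3 := by
  induction n with
  | zero => simp
  | succ n ih => rw [Finset.sum_range_succ, ih, Nat.choose_succ_succ' n 2, add_comm]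

lemma cast_sum_Ico_id {q n : ℕ} (h : q ≤ n) :
    ((∑ k ∈ Finset.Ico q n, k : ℕ) : ℝ) = (n * (n - 1) - q * (q - 1)) / 2 := by
  induction n, h using Nat.le_induction with
  | base => simp
  | succ n hn ih =>
    rw [Finset.sum_Ico_succ_top hn, Nat.cast_add, ih]
    push_cast
    ring

lemma choose_three_add_mul_sum_le {n s t : ℕ} (ht : 1 ≤ t) (hst : t < s)
    (hn : 5 * (s + t) ≤ n) (hn' : 3 * t * n ≤ (s + t) ^ 2) :
    (2 * s + t).choose 3 + t * ∑ k ∈ Finset.Ico (2 * s + t) n, k ≤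
      (s + t).choose 3 + (n - (s + t)) * (s + t).choose 2 := by
  have hpn : s + t ≤ n := by omega
  rw [← Nat.cast_le (α := ℝ)]
  simp only [Nat.cast_add, Nat.cast_mul, cast_sum_Ico_id (by omega : 2 * s + t ≤ n),
    cast_choose_three, Nat.cast_choose_two, Nat.cast_sub hpn]
  have ht' : (1 : ℝ) ≤ t := by exact_mod_cast ht
  have hst' : (t : ℝ) + 1 ≤ s := by exact_mod_cast hst
  have hnr : 5 * ((s : ℝ) + t) ≤ n := by exact_mod_cast hn
  have hnr' : 3 * (t : ℝ) * n ≤ (s + t) ^ 2 := by exact_mod_cast hn'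
  push_cast
  generalize (s : ℝ) = S at *
  generalize (t : ℝ) = T at *
  generalize (n : ℝ) = N at *
  obtain ⟨P, rfl⟩ : ∃ P, S = P - T := ⟨S + T, by ring⟩
  simp only [sub_add_cancel] at *
  -- With q = 2P - T, six times the left side is 3TN(N-1) + q(q-1)(2P-2-4T). After the bounds `hA`,
  -- `hB` and `hC` the cubic terms in P cancel, and the remaining quadratic is positive.
  have hA : 3 * T * N * (N - 1) ≤ P ^ 2 * (N - 1) :=
    mul_le_mul_of_nonneg_right hnr' (by linarith)
  have hB : 5 * P * (P * (2 * P - 3)) ≤ N * (P * (2 * P - 3)) :=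
    mul_le_mul_of_nonneg_right hnr (mul_nonneg (by linarith) (by linarith))
  have hq : (2 * P - T) * (2 * P - T - 1) ≤ (2 * P - 1) * (2 * P - 2) :=
    mul_le_mul (by linarith) (by linarith) (by linarith) (by linarith)
  have hP : 15 * T ≤ P := by
    have h1 : T * (5 * P) ≤ T * N := mul_le_mul_of_nonneg_left hnr (by linarith)
    have h2 : P * (15 * T) ≤ P * P := by nlinarith
    exact le_of_mul_le_mul_left h2 (by linarith)
  have hC : (2 * P - T) * (2 * P - T - 1) * (2 * P - 2 - 4 * T) ≤
      (2 * P - 1) * (2 * P - 2) * (2 * P - 6) :=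
    mul_le_mul hq (by linarith) (by linarith) (mul_nonneg (by linarith) (by linarith))
  have hD : 15 ≤ P := by linarith
  nlinarith [mul_nonneg (by linarith : (0 : ℝ) ≤ P - 15) (by linarith : (0 : ℝ) ≤ P)]

/-- With p = s+t, equality holds at u = 0. In general the first two terms gain pu(u+1)/2 +
u(u²-1)/6, while each of the n-(2s+t) ≥ 3p last links loses u(2p-3-u)/2. -/
lemma choose_three_add_mul_star_le {n s t u : ℕ} (ht : 1 ≤ t) (hus : u < s - t)
    (hn : 5 * (s + t) ≤ n) :
    (s + t + 1 + u).choose 3 + (2 * s + t - (s + t + 1 + u)) * (s + t).choose 2 +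
        (n - (2 * s + t)) * ((s + t - 1) + (s + t - u - 1).choose 2) ≤
      (s + t).choose 3 + (n - (s + t)) * (s + t).choose 2 := by
  rw [← Nat.cast_le (α := ℝ)]
  have e1 : ((2 * s + t - (s + t + 1 + u) : ℕ) : ℝ) = s - 1 - u := by
    rw [Nat.cast_sub (by omega)]; push_cast; ring
  have e2 : ((n - (2 * s + t) : ℕ) : ℝ) = n - (2 * s + t) := by
    rw [Nat.cast_sub (by omega)]; push_cast; ring
  have e3 : ((n - (s + t) : ℕ) : ℝ) = n - (s + t) := by
    rw [Nat.cast_sub (by omega)]; push_cast; ring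
  have e4 : ((s + t - u - 1 : ℕ) : ℝ) = s + t - u - 1 := by
    rw [Nat.cast_sub (by omega), Nat.cast_sub (by omega)]; push_cast; ring
  have e5 : ((s + t - 1 : ℕ) : ℝ) = s + t - 1 := by
    rw [Nat.cast_sub (by omega)]; push_cast; ring
  simp only [Nat.cast_add, Nat.cast_mul, cast_choose_three, Nat.cast_choose_two, e1, e2, e3, e4,
    e5]
  have ht' : (1 : ℝ) ≤ t := by exact_mod_cast ht
  have hu0 : (0 : ℝ) ≤ u := Nat.cast_nonneg u
  have hus' : (u : ℝ) + t + 1 ≤ s := by exact_mod_cast (by omega : u + t + 1 ≤ s)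
  have hnr : 5 * ((s : ℝ) + t) ≤ n := by exact_mod_cast hn
  push_cast
  generalize (s : ℝ) = S at *
  generalize (t : ℝ) = T at *
  generalize (n : ℝ) = N at *
  generalize (u : ℝ) = U at *
  obtain ⟨P, rfl⟩ : ∃ P, S = P - T := ⟨S + T, by ring⟩
  simp only [sub_add_cancel] at *
  have hUP : U ≤ P - 3 := by linarith
  have hA : 3 * P * (U * (2 * P - 3 - U)) ≤ (N - (2 * (P - T) + T)) * (U * (2 * P - 3 - U)) :=
    mul_le_mul_of_nonneg_right (by linarith) (mul_nonneg hu0 (by linarith))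
  have h4 : U * P ≤ (P - 3) * P := mul_le_mul_of_nonneg_right hUP (by linarith)
  have h5 : U * U ≤ P * P := mul_le_mul (by linarith) (by linarith) hu0 (by linarith)
  have hB : 0 ≤ U * (9 * P * (2 * P - 3 - U) - 3 * P * (U + 1) - (U * U - 1)) :=
    mul_nonneg hu0 (by nlinarith)
  linarith

/-! ### The two cases for a shifted family -/

lemma card_le_of_not_mem {n s t i : ℕ} {F : Finset (Finset ℕ)} (hFn : F ⊆ kSubsets n 3)
    (hF : IsShifted F) (ht : 1 ≤ t) (hst : t < s)
    (hn : 5 * (s + t) ≤ n) (hn' : 3 * t * n ≤ (s + t) ^ 2) (hi1 : 2 ≤ i) (hi2 : i ≤ t + 1)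
    (hi : {i, 2 * t + 3 - i, 2 * s + t + 1} ∉ F) :
    F.card ≤ (s + t).choose 3 + (n - (s + t)) * (s + t).choose 2 := by
  refine ((card_le_sum_lowerLink hFn).trans ?_).trans
    (choose_three_add_mul_sum_le ht hst hn hn')
  rw [← Finset.sum_range_add_sum_Ico _ (by omega : 2 * s + t ≤ n), Finset.mul_sum,
    ← sum_range_choose_two]
  refine add_le_add (Finset.sum_le_sum fun k _ => ?_) (Finset.sum_le_sum fun k hk => ?_)
  · refine card_le_choose_two (l := 0) fun a b hab => ?_
    have := mem_lowerLink.1 hab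
    omega
  · rw [Finset.mem_Ico] at hk
    refine card_le_mul_of_cover (c := k + 1) (by omega) fun a b hab => ?_
    obtain ⟨h1, h2, h3, h4⟩ := mem_lowerLink.1 hab
    refine ⟨h1, h2, h3, fun hta => ?_⟩
    -- Here a ≥ t+1 ≥ i and b ≥ 2t+1 ≥ 2t+3-i, so shiftedness would produce the missing triple.
    by_contra hb
    exact hi (hF.triple h4 h2 h3 (by omega) (by omega) (by omega) (by omega) (by omega)
      (by omega))

lemma card_le_of_mem {n s t : ℕ} {F : Finset (Finset ℕ)} (hFn : F ⊆ kSubsets n 3)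
    (hF : IsShifted F) (hU : HasPropU s (2 * s + t) F) (ht : 1 ≤ t) (hst : t < s)
    (hn : 5 * (s + t) ≤ n)
    (hmem : ∀ i, 2 ≤ i → i ≤ t + 1 → {i, 2 * t + 3 - i, 2 * s + t + 1} ∈ F) :
    F.card ≤ (s + t).choose 3 + (n - (s + t)) * (s + t).choose 2 := by
  have hex : ∃ v, {1, s + t + 1, s + t + 2 + v} ∉ F := by
    refine ⟨s - t - 1, fun h => ?_⟩
    -- For u = s-t one has s+t+1-u = 2t+1, so the third triple of the obstruction is the assumed one
    -- with i = 2.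
    refine hU.not_covering hF (u := s - t) (by omega) le_rfl ht hst ?_ hmem ?_
    · convert h using 3; congr 1; omega
    · convert hmem 2 le_rfl (by omega) using 3; omega
  obtain ⟨u, hu, hmin⟩ : ∃ u, {1, s + t + 1, s + t + 2 + u} ∉ F ∧
      ∀ v < u, {1, s + t + 1, s + t + 2 + v} ∈ F :=
    ⟨Nat.find hex, Nat.find_spec hex, fun v hv => not_not.1 (Nat.find_min hex hv)⟩
  have hus : u < s - t := by
    by_contra hcon
    refine hU.not_covering hF (u := s - t) (by omega) le_rfl ht hst ?_ hmem ?_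
    · convert hmin (s - t - 1) (by omega) using 3; congr 1; omega
    · convert hmem 2 le_rfl (by omega) using 3; omega
  have hu2 : {2, s + t + 1 - u, 2 * s + t + 1} ∉ F := by
    -- For u = 0 the triple dominates {1, s+t+1, s+t+2}, which is missing. For u > 0 minimality
    -- supplies {1, s+t+1, s+t+1+u}, and the obstruction applies.
    rcases Nat.eq_zero_or_pos u with rfl | hpos
    · exact fun h => hu (hF.triple h (by omega) (by omega) (by omega) (by omega) (by omega)
        (by omega) (by omega) (by omega))
    · refine hU.not_covering hF hpos (by omega) ht hst ?_ hmem
      convert hmin (u - 1) (by omega) using 3; congr 1; omega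
  have hclique : ∀ k, s + t + 1 + u ≤ k → ∀ a b, (a, b) ∈ lowerLink F (k + 1) →
      b ≤ s + t := by
    intro k hk a b hab
    obtain ⟨h1, h2, h3, h4⟩ := mem_lowerLink.1 hab
    by_contra hb
    exact hu (hF.triple h4 h2 h3 (by omega) (by omega) (by omega) (by omega) (by omega)
      (by omega))
  refine ((card_le_sum_lowerLink hFn).trans ?_).trans
    (choose_three_add_mul_star_le ht hus hn)
  rw [← Finset.sum_range_add_sum_Ico _ (by omega : 2 * s + t ≤ n),
    ← Finset.sum_range_add_sum_Ico _ (by omega : s + t + 1 + u ≤ 2 * s + t),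
    ← sum_range_choose_two (s + t + 1 + u), ← Nat.card_Ico (s + t + 1 + u) (2 * s + t),
    ← Nat.card_Ico (2 * s + t) n]
  -- Three ranges of the largest element k+1: no restriction on its pairs, pairs inside [s+t], and
  -- finally pairs that also contain 1 or lie in [2, s+t-u].
  refine add_le_add (add_le_add (Finset.sum_le_sum fun k _ => ?_)
    (Finset.sum_le_card_nsmul _ _ _ fun k hk => ?_)) (Finset.sum_le_card_nsmul _ _ _ fun k hk => ?_)
  · refine card_le_choose_two (l := 0) fun a b hab => ?_
    have := mem_lowerLink.1 hab
    omega
  · rw [Finset.mem_Ico] at hk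
    refine card_le_choose_two (l := 0) (m := s + t) fun a b hab => ?_
    have h1 := hclique k hk.1 a b hab
    have h2 := mem_lowerLink.1 hab
    omega
  · rw [Finset.mem_Ico] at hk
    refine card_le_star_add_choose_two fun a b hab => ?_
    have h0 := hclique k (by omega) a b hab
    obtain ⟨h1, h2, h3, h4⟩ := mem_lowerLink.1 hab
    refine ⟨h1, h2, h0, fun ha => ?_⟩
    by_contra hb
    exact hu2 (hF.triple h4 h2 h3 (by omega) (by omega) (by omega) (by omega) (by omega)
      (by omega))

theorem mainTheorem5 (n s t : ℕ) (ht : 1 ≤ t) (hst : t < s)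
    (hn_lower : 5 * (s + t) ≤ n)
    (hn_upper : (n : ℝ) ≤ ((s : ℝ) + (t : ℝ)) ^ 2 / (3 * (t : ℝ))) :
    HasPropU s (2 * s + t) (familyA (s + t) 2 n 3) ∧
      ∀ F : Finset (Finset ℕ), F ⊆ kSubsets n 3 → HasPropU s (2 * s + t) F →
        F.card ≤ (familyA (s + t) 2 n 3).card := by
  refine ⟨hasPropU_familyA_two n s t, fun F hFn hU => ?_⟩
  have hn' : 3 * t * n ≤ (s + t) ^ 2 := by
    have ht' : (0 : ℝ) < 3 * t := by exact_mod_cast (by omega : 0 < 3 * t)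
    rw [le_div_iff₀ ht', mul_comm] at hn_upper
    exact_mod_cast hn_upper
  obtain ⟨G, hGn, hGU, hGF, hG⟩ := exists_isShifted F hFn hU
  rw [← hGF]
  refine le_trans ?_ (le_card_familyA_two (by omega))
  by_cases hmem : ∀ i, 2 ≤ i → i ≤ t + 1 → {i, 2 * t + 3 - i, 2 * s + t + 1} ∈ G
  · exact card_le_of_mem hGn hG hGU ht hst hn_lower hmem
  · push Not at hmem
    obtain ⟨i, hi1, hi2, hi⟩ := hmem
    exact card_le_of_not_mem hGn hG ht hst hn_lower hn' hi1 hi2 hi
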